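/- Let $(X_i,\mu_i)$ and $(Y_i,\nu_i)$, $i=1,2$, be Lebesgue spaces with continuous measures, i.e. standard Borel spaces with atomless probability measures. Let $f_i\in L^1(X_i\times Y_i,\mu_i\times\nu_i)$, $i=1,2$, be real-valued integrable functions of two variables. For $f\in L^1(X\times Y,\mu\times\nu)$ we use the following notions; an invertible measure-preserving transformation is understood mod $0$. - $f$ is *pure* if the maps $x\mapsto f(x,\cdot)$ and $y\mapsto f(\cdot,y)$, with values in the classes mod $0$ of functions of the other variable, are one-to-one mod $0$: on some set of full $\mu$-measure, distinct points $x\ne x'$ have $f(x,\cdot)\neq f(x',\cdot)$ on a set of positive $\nu$-measure, and symmetrically in $y$. - $f$ has *trivial symmetry group* if, for invertible measure-preserving transformations $T$ of $(X,\mu)$ and $S$ of $(Y,\nu)$, the equality $f(Tx,Sy)=f(x,y)$ for almost all $(x,y)$ implies $T=\mathrm{id}$ and $S=\mathrm{id}$ almost everywhere. - The *matrix distribution* $D_f$ of $f$ is the law of the infinite random matrix $\big(f(x_n,y_m)\big)_{(n,m)\in\mathbb Z^2}$, where $(x_n)_{n\in\mathbb Z}$ and $(y_m)_{m\in\mathbb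 Z}$ are independent sequences of i.i.d. points with laws $\mu$ and $\nu$. It is a Borel probability measure on $\mathbb R^{\mathbb Z\times\mathbb Z}$. - $f_1$ and $f_2$ are *isomorphic* if there are invertible measure-preserving transformations $T:(X_1,\mu_1)\to(X_2,\mu_2)$ and $S:(Y_1,\nu_1)\to(Y_2,\nu_2)$ with $f_2(Tx,Sy)=f_1(x,y)$ for almost all $(x,y)\in X_1\times Y_1$. **Theorem (recovery theorem).** Suppose that $f_1$ and $f_2$ are pure and have trivial symmetry groups. Then $f_1$ and $f_2$ are isomorphic if and only if $D_{f_1}=D_{f_2}$. That is, for pure integrable functions with trivial symmetry group, the matrix distribution, regarded as a measure on the space of matrices, is a complete isomorphism invariant. -/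

import Mathlib

open MeasureTheory

namespace MatrixDistribution

/-- `T` is an invertible (mod 0) measure-preserving transformation from `(X, μ)` to `(X', μ')`:
it is measurable, carries `μ` to `μ'`, and has a measurable measure-preserving inverse mod 0. -/
def IsInvertibleMP {X X' : Type*} [MeasurableSpace X] [MeasurableSpace X']
    (μ : Measure X) (μ' : Measure X') (T : X → X') : Prop :=
  MeasurePreserving T μ μ' ∧ ∃ R : X' → X, MeasurePreserving R μ' μ ∧
    (∀ᵐ x ∂μ, R (T x) = x) ∧ (∀ᵐ x' ∂μ', T (R x') = x')

/-- Isomorphism of functions of two variables: `f₂(T x, S y) = f₁(x, y)` for almost all `(x, y)`,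
with `T`, `S` invertible measure-preserving transformations of the separate variables. -/
def AreIsomorphic {X₁ Y₁ X₂ Y₂ : Type*} [MeasurableSpace X₁] [MeasurableSpace Y₁]
    [MeasurableSpace X₂] [MeasurableSpace Y₂]
    (μ₁ : Measure X₁) (ν₁ : Measure Y₁) (f₁ : X₁ × Y₁ → ℝ)
    (μ₂ : Measure X₂) (ν₂ : Measure Y₂) (f₂ : X₂ × Y₂ → ℝ) : Prop :=
  ∃ (T : X₁ → X₂) (S : Y₁ → Y₂), IsInvertibleMP μ₁ μ₂ T ∧ IsInvertibleMP ν₁ ν₂ S ∧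
    ∀ᵐ p ∂(μ₁.prod ν₁), f₂ (T p.1, S p.2) = f₁ p

/-- Purity: the maps `x ↦ f(x, ·)` and `y ↦ f(·, y)` into the classes mod 0 of functions of the
other variable are one-to-one mod 0, that is, one-to-one on a set of full measure. -/
def IsPure {X Y : Type*} [MeasurableSpace X] [MeasurableSpace Y]
    (μ : Measure X) (ν : Measure Y) (f : X × Y → ℝ) : Prop :=
  (∃ A : Set X, (∀ᵐ x ∂μ, x ∈ A) ∧
    ∀ x ∈ A, ∀ x' ∈ A, (∀ᵐ y ∂ν, f (x, y) = f (x', y)) → x = x') ∧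
  (∃ B : Set Y, (∀ᵐ y ∂ν, y ∈ B) ∧
    ∀ y ∈ B, ∀ y' ∈ B, (∀ᵐ x ∂μ, f (x, y) = f (x, y')) → y = y')

/-- The symmetry group of `f` is trivial: `f(T x, S y) = f(x, y)` almost everywhere, with `T`, `S`
invertible and measure-preserving, holds only for `T = id`, `S = id` (mod 0). -/
def HasTrivialSymmetryGroup {X Y : Type*} [MeasurableSpace X] [MeasurableSpace Y]
    (μ : Measure X) (ν : Measure Y) (f : X × Y → ℝ) : Prop :=
  ∀ (T : X → X) (S : Y → Y), IsInvertibleMP μ μ T → IsInvertibleMP ν ν S →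
    (∀ᵐ p ∂(μ.prod ν), f (T p.1, S p.2) = f p) →
    (∀ᵐ x ∂μ, T x = x) ∧ (∀ᵐ y ∂ν, S y = y)

/-- The map sending a grid `({x_n}, {y_m})` to the infinite matrix `(f(x_n, y_m))`, with row and
column indices in `ℤ`. -/
def gridMatrix {X Y : Type*} (f : X × Y → ℝ) (g : (ℤ → X) × (ℤ → Y)) : ℤ → ℤ → ℝ :=
  fun n m => f (g.1 n, g.2 m)

/-- The matrix distribution of `f`: the image under `gridMatrix f` of the Bernoulli measure
`μ^∞ × ν^∞` on grids. It is a measure on the space `ℤ → ℤ → ℝ` of infinite real matrices with its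
product σ-algebra. -/
noncomputable def matrixDistribution {X Y : Type*} [MeasurableSpace X] [MeasurableSpace Y]
    (μ : Measure X) [IsProbabilityMeasure μ] (ν : Measure Y) [IsProbabilityMeasure ν]
    (f : X × Y → ℝ) : Measure (ℤ → ℤ → ℝ) :=
  ((Measure.infinitePi (fun _ : ℤ => μ)).prod (Measure.infinitePi (fun _ : ℤ => ν))).map
    (gridMatrix f)

end MatrixDistribution

namespace MatrixDistribution

open Filter Topology ProbabilityTheory

/-! ### Product measures on sequences -/

section Sequences

variable {X Y : Type*} [MeasurableSpace X] [MeasurableSpace Y]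

/-! Cut the grid at index zero. The negatively indexed points are references; the diagonal pairs
`(x_n, y_n)`, `n ≥ 0`, are i.i.d. samples of `μ × ν` independent of them. Each sample has a
`profile`, which is visible in the matrix. By the strong law (`ae_prod_isGeneric`) the matrix almost
surely determines the law of the profile over its own fixed references. Purity makes almost every
choice of references separate points (`ae_isSeparating`), so a point is a measurable function of its
row or column.

If the matrix distributions agree, `exists_map_eq_of_map_eq` yields good grids for both functions
with the same profile sequence, hence the same profile law. Its first two marginals give `T` and `S`
by matching rows and columns, and the last coordinate says that `f₂ (T x, S y) = f₁ (x, y)`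
(`areIsomorphic_of_map_profile_eq`). Conversely, applying `T` and `S` to each grid point carries one
Bernoulli measure to the other. -/

lemma measurePreserving_prodProdProdComm {A B C D : Type*} [MeasurableSpace A] [MeasurableSpace B]
    [MeasurableSpace C] [MeasurableSpace D] (α : Measure A) (β : Measure B) (γ : Measure C)
    (δ : Measure D) [SFinite α] [SFinite β] [SFinite γ] [SFinite δ] :
    MeasurePreserving (fun p : (A × B) × (C × D) => ((p.1.1, p.2.1), (p.1.2, p.2.2)))
      ((α.prod β).prod (γ.prod δ)) ((α.prod γ).prod (β.prod δ)) := by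
  have h₁ := measurePreserving_prodAssoc α β (γ.prod δ)
  have h₂ := (measurePreserving_prodAssoc β γ δ).symm
  have h₃ := (Measure.measurePreserving_swap (μ := β) (ν := γ)).prod (MeasurePreserving.id δ)
  have h₄ := measurePreserving_prodAssoc γ β δ
  have h₅ := (MeasurePreserving.id α).prod (h₄.comp (h₃.comp h₂))
  have h₆ := (measurePreserving_prodAssoc α γ (β.prod δ)).symm
  exact h₆.comp (h₅.comp h₁)

/-- The negatively and the nonnegatively indexed halves of an i.i.d. sequence over `ℤ` are
independent i.i.d. sequences. -/
lemma measurePreserving_halves (μ : Measure X) [IsProbabilityMeasure μ] :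
    MeasurePreserving (fun x : ℤ → X => ((fun n : ℕ => x (Int.negSucc n)), fun n : ℕ => x n))
      (Measure.infinitePi fun _ : ℤ => μ)
      ((Measure.infinitePi fun _ : ℕ => μ).prod (Measure.infinitePi fun _ : ℕ => μ)) := by
  let e : Bool × ℕ → ℤ := fun p => if p.1 then Int.negSucc p.2 else p.2
  have he : Function.Injective e := by
    rintro ⟨a, n⟩ ⟨b, m⟩ h
    cases a <;> cases b <;> simp_all [e]
  have h₁ : MeasurePreserving (fun (x : ℤ → X) p => x (e p)) (Measure.infinitePi fun _ : ℤ => μ)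
      (Measure.infinitePi fun _ : Bool × ℕ => μ) :=
    ⟨by fun_prop, Measure.map_infinitePi_infinitePi_of_inj (P := fun _ : ℤ => μ) he⟩
  have h₂ : MeasurePreserving (MeasurableEquiv.curry Bool ℕ X)
      (Measure.infinitePi fun _ : Bool × ℕ => μ)
      (Measure.infinitePi fun _ : Bool => Measure.infinitePi fun _ : ℕ => μ) :=
    ⟨by fun_prop, Measure.infinitePi_map_curry (fun (_ : Bool) (_ : ℕ) => μ)⟩
  have h₃ : MeasurePreserving (fun x : Bool → ℕ → X => (x true, x false))
      (Measure.infinitePi fun _ : Bool => Measure.infinitePi fun _ : ℕ => μ)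
      ((Measure.infinitePi fun _ : ℕ => μ).prod (Measure.infinitePi fun _ : ℕ => μ)) :=
    ⟨by fun_prop, Measure.infinitePi_map_eval_prod
      (P := fun _ : Bool => Measure.infinitePi fun _ : ℕ => μ) (by simp)⟩
  exact h₃.comp (h₂.comp h₁)

/-- Two independent i.i.d. sequences, zipped together, form an i.i.d. sequence of pairs. -/
lemma measurePreserving_zip (μ : Measure X) [IsProbabilityMeasure μ]
    (ν : Measure Y) [IsProbabilityMeasure ν] :
    MeasurePreserving (fun (p : (ℕ → X) × (ℕ → Y)) n => (p.1 n, p.2 n))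
      ((Measure.infinitePi fun _ : ℕ => μ).prod (Measure.infinitePi fun _ : ℕ => ν))
      (Measure.infinitePi fun _ : ℕ => μ.prod ν) := by
  have hm : Measurable (fun (p : (ℕ → X) × (ℕ → Y)) n => (p.1 n, p.2 n)) := by fun_prop
  refine ⟨hm, Measure.eq_infinitePi _ fun s t ht => ?_⟩
  have hs : MeasurableSet ((s : Set ℕ).pi t) := .pi s.countable_toSet fun _ _ => ht _
  rw [Measure.map_apply hm hs, Measure.prod_apply (hm hs)]
  have hsec : ∀ x : ℕ → X, (Measure.infinitePi fun _ : ℕ => ν)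
      (Prod.mk x ⁻¹' ((fun (p : (ℕ → X) × (ℕ → Y)) n => (p.1 n, p.2 n)) ⁻¹' (s : Set ℕ).pi t)) =
      -- For fixed `x`, a cylinder of pairs is a cylinder in `y`; the factors are then independent
      -- functions of the `x n`.
      ∏ n ∈ s, ν (Prod.mk (x n) ⁻¹' t n) := fun x => by
    rw [← Measure.infinitePi_pi (fun _ : ℕ => ν)
      (fun n _ => measurable_prodMk_left (ht n) : ∀ n ∈ s, MeasurableSet (Prod.mk (x n) ⁻¹' t n))]
    rfl
  simp_rw [hsec]
  have hmeas : ∀ n, Measurable fun a : X => ν (Prod.mk a ⁻¹' t n) := fun n =>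
    measurable_measure_prodMk_left (ht n)
  rw [lintegral_prod_eq_prod_lintegral_of_indepFun s
    (fun n (x : ℕ → X) => ν (Prod.mk (x n) ⁻¹' t n))
    (iIndepFun_infinitePi (P := fun _ : ℕ => μ) hmeas)
    (fun n => (hmeas n).comp (measurable_pi_apply n))]
  refine Finset.prod_congr rfl fun n _ => ?_
  rw [Measure.prod_apply (ht n)]
  exact (measurePreserving_eval_infinitePi (fun _ : ℕ => μ) n).lintegral_comp (hmeas n)

/-- The negatively indexed points of a grid (the reference points), together with the pairs of
nonnegatively indexed points on its diagonal (the sample points). -/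
def splitGrid {X Y : Type*} (g : (ℤ → X) × (ℤ → Y)) : ((ℕ → X) × (ℕ → Y)) × (ℕ → X × Y) :=
  ((fun n => g.1 (Int.negSucc n), fun n => g.2 (Int.negSucc n)), fun n => (g.1 n, g.2 n))

lemma measurePreserving_splitGrid (μ : Measure X) [IsProbabilityMeasure μ]
    (ν : Measure Y) [IsProbabilityMeasure ν] :
    MeasurePreserving splitGrid
      ((Measure.infinitePi fun _ : ℤ => μ).prod (Measure.infinitePi fun _ : ℤ => ν))
      (((Measure.infinitePi fun _ : ℕ => μ).prod (Measure.infinitePi fun _ : ℕ => ν)).prod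
        (Measure.infinitePi fun _ : ℕ => μ.prod ν)) :=
  ((MeasurePreserving.id _).prod (measurePreserving_zip μ ν)).comp
    ((measurePreserving_prodProdProdComm _ _ _ _).comp
      ((measurePreserving_halves μ).prod (measurePreserving_halves ν)))

end Sequences

/-! ### Empirical distributions -/

section Empirical

variable {E : Type*} [MeasurableSpace E] [StandardBorelSpace E]

/-- A countable π-system generating the σ-algebra of a standard Borel space. -/
def cdfSet (E : Type*) [MeasurableSpace E] [StandardBorelSpace E] (q : ℚ) : Set E :=
  embeddingReal E ⁻¹' Set.Iic (q : ℝ)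

lemma measurableSet_cdfSet (q : ℚ) : MeasurableSet (cdfSet E q) :=
  measurable_embeddingReal E measurableSet_Iic

/-- A sequence is generic for a measure if its empirical distributions converge to the measure on
a fixed countable generating π-system. -/
def IsGeneric (ρ : Measure E) (z : ℕ → E) : Prop :=
  ∀ q : ℚ, Tendsto (fun n : ℕ => (∑ i ∈ Finset.range n, (cdfSet E q).indicator (1 : E → ℝ) (z i)) / n)
    atTop (𝓝 (ρ.real (cdfSet E q)))

/-- Limits of frequencies are unique, and rational rays form a generating π-system on the line, into
which `E` embeds. -/
lemma IsGeneric.unique {ρ ρ' : Measure E} [IsProbabilityMeasure ρ] [IsProbabilityMeasure ρ']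
    {z : ℕ → E} (h : IsGeneric ρ z) (h' : IsGeneric ρ' z) : ρ = ρ' := by
  have he := measurableEmbedding_embeddingReal E
  refine he.map_injective ?_
  have := Measure.isProbabilityMeasure_map (μ := ρ) he.measurable.aemeasurable
  have := Measure.isProbabilityMeasure_map (μ := ρ') he.measurable.aemeasurable
  refine ext_of_generate_finite _
    (BorelSpace.measurable_eq.trans Real.borel_eq_generateFrom_Iic_rat)
    Real.isPiSystem_Iic_rat ?_ (by simp)
  intro s hs
  simp only [Set.mem_iUnion, Set.mem_singleton_iff] at hs
  obtain ⟨q, rfl⟩ := hs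
  rw [he.map_apply, he.map_apply, ← measureReal_eq_measureReal_iff]
  exact tendsto_nhds_unique (h q) (h' q)

variable {P Z : Type*} [MeasurableSpace P] [MeasurableSpace Z]

/-- The strong law of large numbers for empirical distributions. -/
lemma ae_isGeneric (ρ : Measure Z) [IsProbabilityMeasure ρ] {Φ : Z → E} (hΦ : Measurable Φ) :
    ∀ᵐ z ∂(Measure.infinitePi fun _ : ℕ => ρ), IsGeneric (ρ.map Φ) (fun n => Φ (z n)) := by
  refine ae_all_iff.2 fun q => ?_
  set φ : Z → ℝ := fun a => (cdfSet E q).indicator (1 : E → ℝ) (Φ a) with hφdef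
  have hind : Measurable ((cdfSet E q).indicator (1 : E → ℝ)) :=
    measurable_one.indicator (measurableSet_cdfSet q)
  have hφ : Measurable φ := hind.comp hΦ
  have heval := fun n => measurePreserving_eval_infinitePi (fun _ : ℕ => ρ) n
  have hbound : ∀ a, ‖φ a‖ ≤ 1 := fun a => by
    simp only [hφdef, Set.indicator]; split_ifs <;> simp
  have hint : Integrable φ ρ :=
    Integrable.of_bound hφ.aestronglyMeasurable 1 (ae_of_all _ hbound)
  have key := strong_law_ae_real (μ := Measure.infinitePi fun _ : ℕ => ρ)
    (fun n z => φ (z n)) ((heval 0).integrable_comp_of_integrable hint)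
    (fun i j hij => (iIndepFun_infinitePi (P := fun _ : ℕ => ρ) (fun _ => hφ)).indepFun hij)
    (fun i => ⟨(hφ.comp (measurable_pi_apply i)).aemeasurable,
      (hφ.comp (measurable_pi_apply 0)).aemeasurable, by
        have h (n : ℕ) : (Measure.infinitePi fun _ : ℕ => ρ).map (fun z => φ (z n)) = ρ.map φ := by
          conv_rhs => rw [← (heval n).map_eq, Measure.map_map hφ (measurable_pi_apply n)]
          rfl
        rw [h, h]⟩)
  have hmean : ∫ z, φ (z 0) ∂(Measure.infinitePi fun _ : ℕ => ρ) =
      (ρ.map Φ).real (cdfSet E q) := by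
    rw [← integral_indicator_one (measurableSet_cdfSet q),
      integral_map hΦ.aemeasurable hind.aestronglyMeasurable]
    conv_rhs => rw [← (heval 0).map_eq]
    exact (integral_map (measurable_pi_apply 0).aemeasurable hφ.aestronglyMeasurable).symm
  rw [hmean] at key
  exact key

/-- Needed to pass from genericity for each fixed parameter to genericity almost everywhere on the
product. -/
lemma measurableSet_isGeneric (ρ : Measure Z) [IsProbabilityMeasure ρ]
    {Φ : P × Z → E} (hΦ : Measurable Φ) :
    MeasurableSet {w : P × (ℕ → Z) |
      IsGeneric (ρ.map fun a => Φ (w.1, a)) (fun n => Φ (w.1, w.2 n))} := by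
    simp only [IsGeneric, Set.ofPred_forall]
    refine MeasurableSet.iInter fun q => ?_
    have hind : Measurable ((cdfSet E q).indicator (1 : E → ℝ)) :=
      measurable_one.indicator (measurableSet_cdfSet q)
    have h (w : P × (ℕ → Z)) : (ρ.map fun a => Φ (w.1, a)).real (cdfSet E q) =
          (ρ (Prod.mk w.1 ⁻¹' (Φ ⁻¹' cdfSet E q))).toReal :=
        map_measureReal_apply (hΦ.comp measurable_prodMk_left) (measurableSet_cdfSet q)
    refine measurableSet_tendsto_fun (fun n => ?_) ?_
    · refine (Finset.measurable_fun_sum _ fun i _ => hind.comp (hΦ.comp ?_)).div_const _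
      fun_prop
    · simp_rw [h]
      exact ((measurable_measure_prodMk_left (hΦ (measurableSet_cdfSet q))).comp
        measurable_fst).ennreal_toReal

/-- The strong law of large numbers for empirical distributions, with an independent parameter. -/
lemma ae_prod_isGeneric (π : Measure P) [SFinite π] (ρ : Measure Z) [IsProbabilityMeasure ρ]
    {Φ : P × Z → E} (hΦ : Measurable Φ) :
    ∀ᵐ w ∂(π.prod (Measure.infinitePi fun _ : ℕ => ρ)),
      IsGeneric (ρ.map fun a => Φ (w.1, a)) (fun n => Φ (w.1, w.2 n)) := by
  let p : P × (ℕ → Z) → Prop := fun w =>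
    IsGeneric (ρ.map fun a => Φ (w.1, a)) (fun n => Φ (w.1, w.2 n))
  have h : ∀ a, ∀ᵐ z ∂(Measure.infinitePi fun _ : ℕ => ρ), p (a, z) := fun a =>
    ae_isGeneric ρ (Φ := fun b => Φ (a, b)) (hΦ.comp measurable_prodMk_left)
  exact (Measure.ae_prod_iff_ae_ae (p := p) (measurableSet_isGeneric ρ hΦ)).2 (ae_of_all _ h)

end Empirical

section Recovery

/-! ### Recovering points from rows -/

/-- A measurable map between standard Borel spaces that is one-to-one mod 0 has a measurable left
inverse mod 0. -/
lemma exists_measurable_leftInverse {X E : Type*} [MeasurableSpace X] [StandardBorelSpace X]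
    [Nonempty X] [MeasurableSpace E] [StandardBorelSpace E] (μ : Measure X) {F : X → E}
    (hF : Measurable F) {A : Set X} (hA : ∀ᵐ x ∂μ, x ∈ A) (hinj : Set.InjOn F A) :
    ∃ R : E → X, Measurable R ∧ ∀ᵐ x ∂μ, R (F x) = x := by
  -- `A` need not be measurable, so shrink it to a conull measurable set; there Lusin–Souslin makes
  -- `F` a measurable embedding.
  have hB : MeasurableSet (toMeasurable μ Aᶜ)ᶜ := (measurableSet_toMeasurable _ _).compl
  have hBA : (toMeasurable μ Aᶜ)ᶜ ⊆ A := Set.compl_subset_comm.1 (subset_toMeasurable μ Aᶜ)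
  have hBμ : ∀ᵐ x ∂μ, x ∈ (toMeasurable μ Aᶜ)ᶜ :=
    compl_mem_ae_iff.2 ((measure_toMeasurable Aᶜ).trans (mem_ae_iff.1 hA))
  set B := (toMeasurable μ Aᶜ)ᶜ
  have := hB.standardBorel
  have hemb : MeasurableEmbedding fun b : B => F b :=
    (hF.comp measurable_subtype_coe).measurableEmbedding
      fun a b hab => Subtype.ext (hinj (hBA a.2) (hBA b.2) hab)
  obtain ⟨R, hR, hRF⟩ := hemb.exists_measurable_extend measurable_subtype_coe fun _ => ‹Nonempty X›
  exact ⟨R, hR, hBμ.mono fun x hx => congrFun hRF ⟨x, hx⟩⟩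

variable {X Y : Type*} [MeasurableSpace X] [MeasurableSpace Y]

/-- The law of `(v b, b)` is concentrated on the graph of `v`, and hence so is that of `(u b, b)`.
-/
lemma ae_eq_of_map_graph_eq (ν : Measure Y) {u v : Y → ℝ} (hu : Measurable u) (hv : Measurable v)
    (h : ν.map (fun b => (u b, b)) = ν.map (fun b => (v b, b))) : ∀ᵐ b ∂ν, u b = v b := by
  have hm : MeasurableSet {p : ℝ × Y | p.1 = v p.2} :=
    measurableSet_eq_fun measurable_fst (hv.comp measurable_snd)
  have h₁ : ∀ᵐ p ∂(ν.map fun b => (v b, b)), p.1 = v p.2 :=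
    (ae_map_iff (by fun_prop) hm).2 (ae_of_all _ fun _ => rfl)
  rw [← h] at h₁
  exact (ae_map_iff (by fun_prop) hm).1 h₁

/-- Almost every sequence of columns separates the points of the row space of a pure function. -/
lemma ae_exists_leftInverse_row [StandardBorelSpace X] [StandardBorelSpace Y]
    (μ : Measure X) [IsProbabilityMeasure μ]
    (ν : Measure Y) [IsProbabilityMeasure ν] {f : X × Y → ℝ} (hf : Measurable f)
    (hpure : ∃ A : Set X, (∀ᵐ x ∂μ, x ∈ A) ∧
      ∀ x ∈ A, ∀ x' ∈ A, (∀ᵐ y ∂ν, f (x, y) = f (x', y)) → x = x') :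
    ∀ᵐ y ∂(Measure.infinitePi fun _ : ℕ => ν), ∃ R : (ℕ → ℝ) → X, Measurable R ∧
      ∀ᵐ x ∂μ, R (fun m => f (x, y m)) = x := by
  have : Nonempty X := nonempty_of_isProbabilityMeasure μ
  obtain ⟨A, hA, hinj⟩ := hpure
  -- Keeping `y` beside the value makes the empirical limit determine `f (x, ·)` mod 0, not merely
  -- its distribution.
  have hgen := ae_prod_isGeneric μ ν (Φ := fun p : X × Y => (f p, p.2)) (by fun_prop)
  have hswap := (Measure.measurePreserving_swap
    (μ := Measure.infinitePi fun _ : ℕ => ν) (ν := μ)).quasiMeasurePreserving.ae hgen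
  filter_upwards [Measure.ae_ae_of_ae_prod hswap] with y hy
  refine exists_measurable_leftInverse μ (by fun_prop) (hA.and hy) ?_
  rintro x ⟨hxA, hx⟩ x' ⟨hxA', hx'⟩ hxx'
  refine hinj x hxA x' hxA' ?_
  have hprob : ∀ a : X, IsProbabilityMeasure (ν.map fun b => (f (a, b), b)) := fun a =>
    Measure.isProbabilityMeasure_map (by fun_prop)
  refine ae_eq_of_map_graph_eq ν (by fun_prop) (by fun_prop) ?_
  have hseq : (fun n => (f (x, y n), y n)) = fun n => (f (x', y n), y n) := by
    funext n
    exact Prod.ext (congrFun hxx' n) rfl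
  have hx₂ : IsGeneric (ν.map fun b => (f (x, b), b)) fun n => (f (x, y n), y n) := hx
  have hx₂' : IsGeneric (ν.map fun b => (f (x', b), b)) fun n => (f (x', y n), y n) := hx'
  rw [hseq] at hx₂
  exact hx₂.unique hx₂'

/-! ### Recovering the function from a generic grid -/

/-- The row of `x` over the reference columns, the column of `y` over the reference rows, and the
value at `(x, y)`. -/
def profile {X Y : Type*} (f : X × Y → ℝ) (p : ((ℕ → X) × (ℕ → Y)) × (X × Y)) :
    (ℕ → ℝ) × (ℕ → ℝ) × ℝ :=
  (fun m => f (p.2.1, p.1.2 m), fun m => f (p.1.1 m, p.2.2), f p.2)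

lemma measurable_profile {f : X × Y → ℝ} (hf : Measurable f) : Measurable (profile f) := by
  unfold profile
  fun_prop

/-- The sequence of profiles of the sample points of a split grid. -/
def profileSeq {X Y : Type*} (f : X × Y → ℝ) (w : ((ℕ → X) × (ℕ → Y)) × (ℕ → X × Y)) :
    ℕ → (ℕ → ℝ) × (ℕ → ℝ) × ℝ :=
  fun n => profile f (w.1, w.2 n)

lemma measurable_profileSeq {f : X × Y → ℝ} (hf : Measurable f) : Measurable (profileSeq f) := by
  have := measurable_profile hf
  unfold profileSeq
  fun_prop

/-- Reference points are good if the rows over them and the columns over them separate points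
mod 0. -/
def IsSeparating (μ : Measure X) (ν : Measure Y) (f : X × Y → ℝ) (r : (ℕ → X) × (ℕ → Y)) : Prop :=
  (∃ R : (ℕ → ℝ) → X, Measurable R ∧ ∀ᵐ x ∂μ, R (fun m => f (x, r.2 m)) = x) ∧
    ∃ R : (ℕ → ℝ) → Y, Measurable R ∧ ∀ᵐ y ∂ν, R (fun m => f (r.1 m, y)) = y

lemma ae_isSeparating [StandardBorelSpace X] [StandardBorelSpace Y]
    (μ : Measure X) [IsProbabilityMeasure μ]
    (ν : Measure Y) [IsProbabilityMeasure ν] {f : X × Y → ℝ} (hf : Measurable f)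
    (hpure : IsPure μ ν f) :
    ∀ᵐ r ∂((Measure.infinitePi fun _ : ℕ => μ).prod (Measure.infinitePi fun _ : ℕ => ν)),
      IsSeparating μ ν f r :=
  (Measure.quasiMeasurePreserving_snd.ae (ae_exists_leftInverse_row μ ν hf hpure.1)).and
    (Measure.quasiMeasurePreserving_fst.ae (ae_exists_leftInverse_row ν μ
      (f := fun p => f p.swap) (by fun_prop) hpure.2))

section CommonLaw

variable {A B E : Type*} [MeasurableSpace A] [MeasurableSpace B] [MeasurableSpace E]
  {α : Measure A} {β : Measure B} {F : A → E} {F' : B → E} {R : E → A} {R' : E → B}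

lemma measurePreserving_comp_of_map_eq (hF : Measurable F) (hF' : Measurable F')
    (hR' : Measurable R') (hRF' : ∀ᵐ b ∂β, R' (F' b) = b) (hmap : α.map F = β.map F') :
    MeasurePreserving (R' ∘ F) α β := by
  refine ⟨hR'.comp hF, ?_⟩
  rw [← Measure.map_map hR' hF, hmap, Measure.map_map hR' hF']
  exact (Measure.map_congr hRF').trans Measure.map_id

/-- The identity `F' ∘ R' = id` holds almost everywhere for the law of `F'`, which is also the law
of `F`. -/
lemma ae_comp_leftInverse_eq [StandardBorelSpace E] (hF : Measurable F) (hF' : Measurable F')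
    (hR' : Measurable R') (hRF' : ∀ᵐ b ∂β, R' (F' b) = b) (hmap : α.map F = β.map F') :
    ∀ᵐ a ∂α, F' (R' (F a)) = F a := by
  have hm : MeasurableSet {e : E | F' (R' e) = e} :=
    measurableSet_eq_fun (hF'.comp hR') measurable_id
  have h : ∀ᵐ e ∂(β.map F'), F' (R' e) = e :=
    (ae_map_iff hF'.aemeasurable hm).2 (hRF'.mono fun b hb => congrArg F' hb)
  rw [← hmap] at h
  exact (ae_map_iff hF.aemeasurable hm).1 h

/-- Two maps with the same law, both with measurable left inverses mod 0, differ by an invertible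
measure-preserving transformation. -/
lemma isInvertibleMP_of_map_eq [StandardBorelSpace E] (hF : Measurable F) (hF' : Measurable F') (hR : Measurable R)
    (hR' : Measurable R') (hRF : ∀ᵐ a ∂α, R (F a) = a) (hRF' : ∀ᵐ b ∂β, R' (F' b) = b)
    (hmap : α.map F = β.map F') : IsInvertibleMP α β (R' ∘ F) := by
  refine ⟨measurePreserving_comp_of_map_eq hF hF' hR' hRF' hmap, R ∘ F',
    measurePreserving_comp_of_map_eq hF' hF hR hRF hmap.symm, ?_, ?_⟩
  · filter_upwards [hRF, ae_comp_leftInverse_eq hF hF' hR' hRF' hmap] with a ha ha'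
    simp only [Function.comp_apply, ha', ha]
  · filter_upwards [hRF', ae_comp_leftInverse_eq hF' hF hR hRF hmap.symm] with b hb hb'
    simp only [Function.comp_apply, hb', hb]

/-- Two maps with the same law take a common value at points of any given conull sets. -/
lemma exists_map_eq_of_map_eq [StandardBorelSpace A] [StandardBorelSpace B] [StandardBorelSpace E]
    [NeZero α] (hF : Measurable F) (hF' : Measurable F') (hmap : α.map F = β.map F')
    {p : A → Prop} {q : B → Prop} (hp : ∀ᵐ a ∂α, p a) (hq : ∀ᵐ b ∂β, q b) :
    ∃ a b, p a ∧ q b ∧ F a = F' b := by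
  by_contra! hne
  let := upgradeStandardBorel E
  obtain ⟨U, hUp, hU, hU0⟩ := exists_measurable_superset_of_null (ae_iff.1 hp)
  obtain ⟨V, hVq, hV, hV0⟩ := exists_measurable_superset_of_null (ae_iff.1 hq)
  -- Disjoint analytic images have a Borel separator `W`; the common law would then vanish on both
  -- `W` and its complement.
  have hdisj : Disjoint (F '' Uᶜ) (F' '' Vᶜ) := by
    rw [Set.disjoint_left]
    rintro _ ⟨a, ha, rfl⟩ ⟨b, hb, hab⟩
    exact hne a b (by_contra fun h => ha (hUp h)) (by_contra fun h => hb (hVq h)) hab.symm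
  obtain ⟨W, hUW, hVW, hW⟩ := AnalyticSet.measurablySeparable
    (hU.compl.analyticSet_image hF) (hV.compl.analyticSet_image hF') hdisj
  have h₁ : α.map F Wᶜ = 0 := by
    rw [Measure.map_apply hF hW.compl]
    exact measure_mono_null (fun a ha => by_contra fun h => ha (hUW ⟨a, h, rfl⟩)) hU0
  have h₂ : β.map F' W = 0 := by
    rw [Measure.map_apply hF' hW]
    exact measure_mono_null
      (fun b hb => by_contra fun h => Set.disjoint_left.1 hVW ⟨b, h, rfl⟩ hb) hV0
  rw [← hmap] at h₂
  have h₃ : α.map F Set.univ = 0 := by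
    rw [← Set.union_compl_self W]
    exact measure_union_null h₂ h₁
  rw [Measure.map_apply hF .univ, Set.preimage_univ] at h₃
  exact NeZero.ne α (Measure.measure_univ_eq_zero.1 h₃)

end CommonLaw

variable {X₁ Y₁ X₂ Y₂ : Type*}
    [MeasurableSpace X₁] [MeasurableSpace Y₁] [MeasurableSpace X₂] [MeasurableSpace Y₂]
    {μ₁ : Measure X₁} [IsProbabilityMeasure μ₁] {ν₁ : Measure Y₁} [IsProbabilityMeasure ν₁]
    {μ₂ : Measure X₂} [IsProbabilityMeasure μ₂] {ν₂ : Measure Y₂} [IsProbabilityMeasure ν₂]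

lemma areIsomorphic_of_map_profile_eq {f₁ : X₁ × Y₁ → ℝ} {f₂ : X₂ × Y₂ → ℝ}
    (hf₁ : Measurable f₁) (hf₂ : Measurable f₂) {r₁ : (ℕ → X₁) × (ℕ → Y₁)}
    {r₂ : (ℕ → X₂) × (ℕ → Y₂)} (h₁ : IsSeparating μ₁ ν₁ f₁ r₁) (h₂ : IsSeparating μ₂ ν₂ f₂ r₂)
    (hmap : (μ₁.prod ν₁).map (fun p => profile f₁ (r₁, p)) =
      (μ₂.prod ν₂).map (fun p => profile f₂ (r₂, p))) :
    AreIsomorphic μ₁ ν₁ f₁ μ₂ ν₂ f₂ := by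
  obtain ⟨⟨R₁, hR₁, hRF₁⟩, ⟨Q₁, hQ₁, hQG₁⟩⟩ := h₁
  obtain ⟨⟨R₂, hR₂, hRF₂⟩, ⟨Q₂, hQ₂, hQG₂⟩⟩ := h₂
  have hm₁ : Measurable fun p => profile f₁ (r₁, p) :=
    (measurable_profile hf₁).comp measurable_prodMk_left
  have hm₂ : Measurable fun p => profile f₂ (r₂, p) :=
    (measurable_profile hf₂).comp measurable_prodMk_left
  have hF : μ₁.map (fun x m => f₁ (x, r₁.2 m)) = μ₂.map (fun x m => f₂ (x, r₂.2 m)) := by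
    have h := congrArg (Measure.map Prod.fst) hmap
    rw [Measure.map_map measurable_fst hm₁, Measure.map_map measurable_fst hm₂] at h
    rw [← (measurePreserving_fst (μ := μ₁) (ν := ν₁)).map_eq,
      ← (measurePreserving_fst (μ := μ₂) (ν := ν₂)).map_eq,
      Measure.map_map (by fun_prop) measurable_fst, Measure.map_map (by fun_prop) measurable_fst]
    exact h
  have hG : ν₁.map (fun y m => f₁ (r₁.1 m, y)) = ν₂.map (fun y m => f₂ (r₂.1 m, y)) := by
    have h := congrArg (Measure.map fun z : (ℕ → ℝ) × (ℕ → ℝ) × ℝ => z.2.1) hmap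
    rw [Measure.map_map (by fun_prop) hm₁, Measure.map_map (by fun_prop) hm₂] at h
    rw [← (measurePreserving_snd (μ := μ₁) (ν := ν₁)).map_eq,
      ← (measurePreserving_snd (μ := μ₂) (ν := ν₂)).map_eq,
      Measure.map_map (by fun_prop) measurable_snd, Measure.map_map (by fun_prop) measurable_snd]
    exact h
  refine ⟨_, _, isInvertibleMP_of_map_eq (by fun_prop) (by fun_prop) hR₁ hR₂ hRF₁ hRF₂ hF,
    isInvertibleMP_of_map_eq (by fun_prop) (by fun_prop) hQ₁ hQ₂ hQG₁ hQG₂ hG, ?_⟩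
  have hm : MeasurableSet {z : (ℕ → ℝ) × (ℕ → ℝ) × ℝ | f₂ (R₂ z.1, Q₂ z.2.1) = z.2.2} :=
    measurableSet_eq_fun (by fun_prop) (by fun_prop)
  -- In the second system the value is a function of row and column; this is a property of the law,
  -- so it transfers to the first.
  have h : ∀ᵐ z ∂((μ₂.prod ν₂).map fun p => profile f₂ (r₂, p)),
      f₂ (R₂ z.1, Q₂ z.2.1) = z.2.2 := by
    rw [ae_map_iff hm₂.aemeasurable hm]
    filter_upwards [Measure.quasiMeasurePreserving_fst.ae hRF₂,
      Measure.quasiMeasurePreserving_snd.ae hQG₂] with p hp hq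
    simp only [profile]
    rw [hp, hq]
  rw [← hmap] at h
  exact (ae_map_iff hm₁.aemeasurable hm).1 h

/-- The array of profiles, read off from the entries of a matrix. -/
def matrixProfile (M : ℤ → ℤ → ℝ) : ℕ → (ℕ → ℝ) × (ℕ → ℝ) × ℝ :=
  fun n => (fun m => M n (Int.negSucc m), fun m => M (Int.negSucc m) n, M n n)

lemma measurable_matrixProfile : Measurable matrixProfile := by
  unfold matrixProfile
  fun_prop

lemma measurable_gridMatrix {f : X × Y → ℝ} (hf : Measurable f) : Measurable (gridMatrix f) := by
  unfold gridMatrix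
  fun_prop

lemma map_matrixProfile_matrixDistribution (μ : Measure X) [IsProbabilityMeasure μ]
    (ν : Measure Y) [IsProbabilityMeasure ν] {f : X × Y → ℝ} (hf : Measurable f) :
    (matrixDistribution μ ν f).map matrixProfile =
      (((Measure.infinitePi fun _ : ℕ => μ).prod (Measure.infinitePi fun _ : ℕ => ν)).prod
        (Measure.infinitePi fun _ : ℕ => μ.prod ν)).map (profileSeq f) := by
  rw [matrixDistribution, Measure.map_map measurable_matrixProfile (measurable_gridMatrix hf),
    ← (measurePreserving_splitGrid μ ν).map_eq,
    Measure.map_map (measurable_profileSeq hf) (measurePreserving_splitGrid μ ν).measurable]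
  rfl

lemma areIsomorphic_of_matrixDistribution_eq [StandardBorelSpace X₁] [StandardBorelSpace Y₁]
    [StandardBorelSpace X₂] [StandardBorelSpace Y₂]
    {f₁ : X₁ × Y₁ → ℝ} {f₂ : X₂ × Y₂ → ℝ}
    (hf₁ : Measurable f₁) (hf₂ : Measurable f₂) (hpure₁ : IsPure μ₁ ν₁ f₁)
    (hpure₂ : IsPure μ₂ ν₂ f₂)
    (hD : matrixDistribution μ₁ ν₁ f₁ = matrixDistribution μ₂ ν₂ f₂) :
    AreIsomorphic μ₁ ν₁ f₁ μ₂ ν₂ f₂ := by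
  have hmap := congrArg (Measure.map matrixProfile) hD
  rw [map_matrixProfile_matrixDistribution μ₁ ν₁ hf₁,
    map_matrixProfile_matrixDistribution μ₂ ν₂ hf₂] at hmap
  have : StandardBorelSpace ((ℕ → ℝ) × (ℕ → ℝ) × ℝ) := inferInstance
  have : StandardBorelSpace (ℕ → (ℕ → ℝ) × (ℕ → ℝ) × ℝ) :=
    StandardBorelSpace.pi_countable
  -- One profile sequence is now generic for both profile laws, which forces them to coincide.
  obtain ⟨w₁, w₂, ⟨hs₁, hg₁⟩, ⟨hs₂, hg₂⟩, heq⟩ := exists_map_eq_of_map_eq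
    (measurable_profileSeq hf₁) (measurable_profileSeq hf₂) hmap
    ((Measure.quasiMeasurePreserving_fst.ae (ae_isSeparating μ₁ ν₁ hf₁ hpure₁)).and
      (ae_prod_isGeneric _ (μ₁.prod ν₁) (measurable_profile hf₁)))
    ((Measure.quasiMeasurePreserving_fst.ae (ae_isSeparating μ₂ ν₂ hf₂ hpure₂)).and
      (ae_prod_isGeneric _ (μ₂.prod ν₂) (measurable_profile hf₂)))
  refine areIsomorphic_of_map_profile_eq hf₁ hf₂ hs₁ hs₂ ?_
  have : IsProbabilityMeasure ((μ₁.prod ν₁).map fun p => profile f₁ (w₁.1, p)) :=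
    Measure.isProbabilityMeasure_map
      ((measurable_profile hf₁).comp (measurable_prodMk_left (x := w₁.1))).aemeasurable
  have : IsProbabilityMeasure ((μ₂.prod ν₂).map fun p => profile f₂ (w₂.1, p)) :=
    Measure.isProbabilityMeasure_map
      ((measurable_profile hf₂).comp (measurable_prodMk_left (x := w₂.1))).aemeasurable
  exact IsGeneric.unique (z := profileSeq f₁ w₁) hg₁ (heq ▸ hg₂)

end Recovery

/-! ### Invariance of the notions under changes on null sets -/

section Invariance

variable {X₁ Y₁ X₂ Y₂ : Type*}
    [MeasurableSpace X₁] [MeasurableSpace Y₁] [MeasurableSpace X₂] [MeasurableSpace Y₂]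
    {μ₁ : Measure X₁} {ν₁ : Measure Y₁} {μ₂ : Measure X₂} {ν₂ : Measure Y₂}

lemma exists_ae_injective_congr [SFinite ν₁]
    {f g : X₁ × Y₁ → ℝ} (hfg : f =ᵐ[μ₁.prod ν₁] g)
    (h : ∃ A : Set X₁, (∀ᵐ x ∂μ₁, x ∈ A) ∧
      ∀ x ∈ A, ∀ x' ∈ A, (∀ᵐ y ∂ν₁, f (x, y) = f (x', y)) → x = x') :
    ∃ A : Set X₁, (∀ᵐ x ∂μ₁, x ∈ A) ∧
      ∀ x ∈ A, ∀ x' ∈ A, (∀ᵐ y ∂ν₁, g (x, y) = g (x', y)) → x = x' := by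
  obtain ⟨A, hA, hinj⟩ := h
  -- By Fubini, almost every section of `f` agrees mod 0 with that of `g`.
  refine ⟨{x | x ∈ A ∧ ∀ᵐ y ∂ν₁, f (x, y) = g (x, y)}, hA.and (Measure.ae_ae_of_ae_prod hfg), ?_⟩
  rintro x ⟨hx, hxg⟩ x' ⟨hx', hxg'⟩ hxx'
  refine hinj x hx x' hx' ?_
  filter_upwards [hxg, hxg', hxx'] with y h₁ h₂ h₃
  rw [h₁, h₂, h₃]

lemma IsPure.congr [SFinite μ₁] [SFinite ν₁]
    {f g : X₁ × Y₁ → ℝ} (hfg : f =ᵐ[μ₁.prod ν₁] g) (h : IsPure μ₁ ν₁ f) :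
    IsPure μ₁ ν₁ g :=
  ⟨exists_ae_injective_congr hfg h.1,
    exists_ae_injective_congr (f := fun p => f p.swap) (g := fun p => g p.swap)
      (Measure.measurePreserving_swap.quasiMeasurePreserving.ae hfg) h.2⟩

lemma AreIsomorphic.congr [SFinite μ₁] [SFinite ν₁]
    {f₁ g₁ : X₁ × Y₁ → ℝ} {f₂ g₂ : X₂ × Y₂ → ℝ}
    (h₁ : f₁ =ᵐ[μ₁.prod ν₁] g₁) (h₂ : f₂ =ᵐ[μ₂.prod ν₂] g₂)
    (h : AreIsomorphic μ₁ ν₁ f₁ μ₂ ν₂ f₂) : AreIsomorphic μ₁ ν₁ g₁ μ₂ ν₂ g₂ := by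
  obtain ⟨T, S, hT, hS, hTS⟩ := h
  refine ⟨T, S, hT, hS, ?_⟩
  filter_upwards [h₁, hTS, (hT.1.prod hS.1).quasiMeasurePreserving.ae h₂] with p hp₁ hp hp₂
  rw [← hp₁, ← hp]
  exact hp₂.symm

lemma gridMatrix_ae_eq [IsProbabilityMeasure μ₁] [IsProbabilityMeasure ν₁]
    {f g : X₁ × Y₁ → ℝ} (hfg : f =ᵐ[μ₁.prod ν₁] g) :
    gridMatrix f =ᵐ[(Measure.infinitePi fun _ : ℤ => μ₁).prod (Measure.infinitePi fun _ : ℤ => ν₁)]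
      gridMatrix g := by
  have h : ∀ᵐ w ∂((Measure.infinitePi fun _ : ℤ => μ₁).prod (Measure.infinitePi fun _ : ℤ => ν₁)),
      ∀ n m : ℤ, f (w.1 n, w.2 m) = g (w.1 n, w.2 m) :=
    -- There are countably many entries, and each `(x_n, y_m)` has law `μ₁ × ν₁`.
    ae_all_iff.2 fun n => ae_all_iff.2 fun m =>
      ((measurePreserving_eval_infinitePi (fun _ : ℤ => μ₁) n).prod
        (measurePreserving_eval_infinitePi (fun _ : ℤ => ν₁) m)).quasiMeasurePreserving.ae hfg
  filter_upwards [h] with w hw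
  funext n m
  exact hw n m

lemma matrixDistribution_congr [IsProbabilityMeasure μ₁] [IsProbabilityMeasure ν₁]
    {f g : X₁ × Y₁ → ℝ} (hfg : f =ᵐ[μ₁.prod ν₁] g) :
    matrixDistribution μ₁ ν₁ f = matrixDistribution μ₁ ν₁ g :=
  Measure.map_congr (gridMatrix_ae_eq hfg)

lemma measurePreserving_infinitePi_comp [IsProbabilityMeasure μ₁] [IsProbabilityMeasure μ₂]
    {T : X₁ → X₂} (hT : MeasurePreserving T μ₁ μ₂) :
    MeasurePreserving (fun (x : ℤ → X₁) n => T (x n)) (Measure.infinitePi fun _ : ℤ => μ₁)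
      (Measure.infinitePi fun _ : ℤ => μ₂) := by
  have hm := hT.measurable
  refine ⟨by fun_prop, ?_⟩
  rw [Measure.infinitePi_map_pi (fun _ : ℤ => μ₁) (fun _ => hm), hT.map_eq]

lemma AreIsomorphic.matrixDistribution_eq [IsProbabilityMeasure μ₁] [IsProbabilityMeasure ν₁]
    [IsProbabilityMeasure μ₂] [IsProbabilityMeasure ν₂]
    {f₁ : X₁ × Y₁ → ℝ} {f₂ : X₂ × Y₂ → ℝ}
    (hf₂ : Measurable (gridMatrix f₂)) (h : AreIsomorphic μ₁ ν₁ f₁ μ₂ ν₂ f₂) :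
    matrixDistribution μ₁ ν₁ f₁ = matrixDistribution μ₂ ν₂ f₂ := by
  obtain ⟨T, S, hT, hS, hTS⟩ := h
  have hmp := (measurePreserving_infinitePi_comp hT.1).prod (measurePreserving_infinitePi_comp hS.1)
  have h₁ : matrixDistribution μ₁ ν₁ f₁ =
      matrixDistribution μ₁ ν₁ fun p => f₂ (T p.1, S p.2) :=
    matrixDistribution_congr (hTS.mono fun _ hp => hp.symm)
  rw [h₁, matrixDistribution, matrixDistribution, ← hmp.map_eq, Measure.map_map hf₂ hmp.measurable]
  rfl

end Invariance

end MatrixDistribution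

theorem theorem1
    {X₁ Y₁ X₂ Y₂ : Type*}
    [MeasurableSpace X₁] [StandardBorelSpace X₁] [MeasurableSpace Y₁] [StandardBorelSpace Y₁]
    [MeasurableSpace X₂] [StandardBorelSpace X₂] [MeasurableSpace Y₂] [StandardBorelSpace Y₂]
    (μ₁ : Measure X₁) [IsProbabilityMeasure μ₁] [NullSingletonClass μ₁]
    (ν₁ : Measure Y₁) [IsProbabilityMeasure ν₁] [NullSingletonClass ν₁]
    (μ₂ : Measure X₂) [IsProbabilityMeasure μ₂] [NullSingletonClass μ₂]
    (ν₂ : Measure Y₂) [IsProbabilityMeasure ν₂] [NullSingletonClass ν₂]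
    (f₁ : X₁ × Y₁ → ℝ) (f₂ : X₂ × Y₂ → ℝ)
    (hint₁ : Integrable f₁ (μ₁.prod ν₁)) (hint₂ : Integrable f₂ (μ₂.prod ν₂))
    (hpure₁ : MatrixDistribution.IsPure μ₁ ν₁ f₁) (hpure₂ : MatrixDistribution.IsPure μ₂ ν₂ f₂)
    (hsym₁ : MatrixDistribution.HasTrivialSymmetryGroup μ₁ ν₁ f₁)
    (hsym₂ : MatrixDistribution.HasTrivialSymmetryGroup μ₂ ν₂ f₂) :
    MatrixDistribution.matrixDistribution μ₁ ν₁ f₁ =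
        MatrixDistribution.matrixDistribution μ₂ ν₂ f₂ ↔
      MatrixDistribution.AreIsomorphic μ₁ ν₁ f₁ μ₂ ν₂ f₂ := by
  -- Purity, isomorphism and the matrix distribution are insensitive to null sets, so measurable
  -- versions may be used.
  obtain ⟨g₁, hg₁, hfg₁⟩ := hint₁.aemeasurable
  obtain ⟨g₂, hg₂, hfg₂⟩ := hint₂.aemeasurable
  rw [MatrixDistribution.matrixDistribution_congr hfg₁,
    MatrixDistribution.matrixDistribution_congr hfg₂]
  refine ⟨fun hD => ?_, fun h => ?_⟩
  · exact (MatrixDistribution.areIsomorphic_of_matrixDistribution_eq hg₁ hg₂ (hpure₁.congr hfg₁)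
      (hpure₂.congr hfg₂) hD).congr hfg₁.symm hfg₂.symm
  · exact (h.congr hfg₁ hfg₂).matrixDistribution_eq (MatrixDistribution.measurable_gridMatrix hg₂)
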